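/- Setup. Let $\mathbb{F}_q$ be a finite field and let $N\ge 3$. A library consists of $N$ files $W_1,\dots,W_N$, each made of $F$ samples; all samples are independent and uniform on $\mathbb{F}_q$. There are $K=3$ users with Hamming-distortion requirements $1-\frac1q\ge D_1\ge D_2\ge D_3\ge 0$, and the target rates are $r_k=\rho(D_k)$, where $\rho(D)=\log_2 q-H(D)-D\log_2(q-1)$ and $H$ is the binary entropy function in bits. For normalized cache sizes $\bm m=(m_1,m_2,m_3)$ put $M_k=Nm_k$. A caching scheme of delivery load $R$ for file size $F$ consists of: numbers $v_{\mathcal T}\ge 0$ for the nonempty $\mathcal T\subseteq\{1,2,3\}$, with $\sum_{\mathcal T}v_{\mathcal T}=R$; cache contents $Z_k=\varphi_k(W_1,\dots,W_N)\in[2^{M_kF}]$; for each demand vector $\bm d\in[N]^3$ and each $\mathcal T$, a signal $X_{\mathcal T,\bm d}=\psi_{\mathcal T,\bm d}(W_{d_1},W_{d_2},W_{d_3})\in[2^{v_{\mathcal T}F}]$; and reconstructions $\hat W_{d_k}=\mu_{\bm d,k}\big((X_{\mathcal T,\bm d})_{\mathcal T},Z_k\big)\in\mathbb{F}_q^F$.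 Here $[x]=\{1,\dots,\lfloor x\rfloor\}$. The load $R$ is achievable for $\bm m$ if there is a sequence of caching schemes of load $R$, one for each $F$, such that for every $\bm d\in[N]^3$ and every user $k$ the expected fraction of the samples of $W_{d_k}$ that differ from those of $\hat W_{d_k}$ has limit superior at most $D_k$ as $F\to\infty$. Let $R^*(\bm m,\bm r)$ be the infimum of the achievable loads, and let $R^*(m_{\text{tot}},\bm r)$ be the infimum of $R^*(\bm m,\bm r)$ over all $\bm m$ with $0\le m_k\le r_k$ and $\sum_{k=1}^3 m_k=m_{\text{tot}}$. Corollary 1 (three-user cut-set bound). For all $N\ge 3$, all such $D_1,D_2,D_3$ with target rates $\bm r=(r_1,r_2,r_3)$, and every $m_{\text{tot}}\in[0,\,r_1+r_2+r_3]$, $$R^*(m_{\text{tot}},\bm r)\ \ge\ \max\left\{\sum_{l=1}^{3} r_l-\frac{N}{\lfloor N/3\rfloor}\,m_{\text{tot}},\ \ \frac{\lfloor N/2\rfloor(r_1+r_2)+N r_3}{N+\lfloor N/2\rfloor}-\frac{N}{N+\lfloor N/2\rfloor}\,m_{\text{tot}},\ \ \frac13\Big(\sum_{l=1}^{3} r_l-m_{\text{tot}}\Big)\right\}.$$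 -/

import Mathlib

namespace CodedCaching

/-- The rate-distortion function, in bits per sample, of a uniform source on `q` letters under
Hamming distortion: `log₂ q - H(D) - D log₂ (q - 1)`, with `H` the binary entropy in bits. -/
noncomputable def rateDistortion (q : ℕ) (D : ℝ) : ℝ :=
  Real.logb 2 q - Real.binEntropy D / Real.log 2 - D * Real.logb 2 ((q : ℝ) - 1)

open Classical in
/-- The Hamming distortion of one sample. -/
noncomputable def distortion {A : Type*} (s t : A) : ℝ := if s = t then 0 else 1

/-- A file: `F` samples from the alphabet `A`. -/
abbrev File (A : Type*) (F : ℕ) : Type _ := Fin F → A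

/-- The set `[2 ^ b]` of messages of (real) length `b` bits; it has `⌊2 ^ b⌋` elements. -/
abbrev Message (b : ℝ) : Type := Fin ⌊(2 : ℝ) ^ b⌋₊

/-- The nonempty sets of users. -/
abbrev UserSet (K : ℕ) : Type := {T : Finset (Fin K) // T.Nonempty}

/-- A caching scheme for `N` files of `F` samples from the alphabet `A` and for `K` users, with
cache sizes `M k * F` bits and total delivery load `R * F` bits. -/
structure CachingScheme (A : Type*) (K N F : ℕ) (M : Fin K → ℝ) (R : ℝ) where
  /-- the normalized length of the signal sent to each set of users -/
  v : UserSet K → ℝ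
  v_nonneg : ∀ T, 0 ≤ v T
  v_sum : ∑ T, v T = R
  /-- the cache placement functions; they do not know the demands -/
  place : (k : Fin K) → (Fin N → File A F) → Message (M k * F)
  /-- the encoding functions, which map the requested files to the signals -/
  encode : (T : UserSet K) → (d : Fin K → Fin N) → (Fin K → File A F) → Message (v T * F)
  /-- the decoding functions, which map the signals and a user's cache to a reconstruction -/
  decode : (d : Fin K → Fin N) → (k : Fin K) → ((T : UserSet K) → Message (v T * F)) →
    Message (M k * F) → File A F

/-- What user `k` reconstructs when the library is `W` and the demand vector is `d`. -/
def CachingScheme.output {A : Type*} {K N F : ℕ} {M : Fin K → ℝ} {R : ℝ}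
    (s : CachingScheme A K N F M R) (d : Fin K → Fin N) (k : Fin K) (W : Fin N → File A F) :
    File A F :=
  s.decode d k (fun T => s.encode T d (fun j => W (d j))) (s.place k W)

/-- The expected per-sample distortion at user `k` under the demand vector `d`. The samples of all
files are independent and uniform on `A`, that is, the library is uniform on `(A ^ F) ^ N`. -/
noncomputable def CachingScheme.avgDistortion {A : Type*} [Fintype A] {K N F : ℕ}
    {M : Fin K → ℝ} {R : ℝ} (s : CachingScheme A K N F M R) (d : Fin K → Fin N) (k : Fin K) : ℝ :=
  (∑ W : Fin N → File A F, (1 / (F : ℝ)) * ∑ i, distortion (W (d k) i) (s.output d k W i)) /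
    (Fintype.card (Fin N → File A F) : ℝ)

/-- The delivery load `R` is achievable for the normalized cache sizes `m` (user `k` has a cache of
`N * m k * F` bits) and the distortion requirements `D`: there is a sequence of caching schemes
under which, for every demand vector, the limiting average distortion at user `k` is at most
`D k`. -/
def Achievable (A : Type*) [Fintype A] {K : ℕ} (N : ℕ) (D m : Fin K → ℝ) (R : ℝ) : Prop :=
  ∃ s : (F : ℕ) → CachingScheme A K N F (fun k => N * m k) R,
    ∀ (d : Fin K → Fin N) (k : Fin K),
      Filter.limsup (fun F => (s F).avgDistortion d k) Filter.atTop ≤ D k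

/-- The infimum `R*(m, r)` of the achievable delivery loads for the normalized cache sizes `m`,
where `r k` is the rate of the distortion requirement `D k`. It would be `⊤` if there were no
achievable load. -/
noncomputable def optimalLoad (A : Type*) [Fintype A] {K : ℕ} (N : ℕ) (D m : Fin K → ℝ) : EReal :=
  ⨅ (R : ℝ) (_ : Achievable A N D m R), (R : EReal)

/-- The normalized cache allocations `m` with `0 ≤ m k ≤ r k` that use exactly the budget. -/
def allocations {K : ℕ} (mtot : ℝ) (r : Fin K → ℝ) : Set (Fin K → ℝ) :=
  {m | (∀ k, 0 ≤ m k ∧ m k ≤ r k) ∧ ∑ k, m k = mtot}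

/-- The infimum `R*(mtot, r)` of the achievable delivery loads under the normalized total cache
memory budget `mtot`, where `r k` is the rate of the distortion requirement `D k`. -/
noncomputable def optimalLoadBudget (A : Type*) [Fintype A] {K : ℕ} (N : ℕ) (mtot : ℝ)
    (D : Fin K → ℝ) : EReal :=
  ⨅ m ∈ allocations mtot (fun k => rateDistortion (Fintype.card A) (D k)), optimalLoad A N D m

end CodedCaching

namespace CodedCaching

open Filter Topology

/-! Let some users make `T` rounds of demands, all for distinct files. The `T` deliveries and a
single copy of these users' caches form a message of at most `(T * R + N * ∑ m) * F` bits that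
describes every requested file, so lossy source coding forces `T * ∑ r ≤ T * R + N * ∑ m`
(`Achievable.cutSet`). The three bounds are linear combinations of this inequality for all users,
for the first two, and for single users.

The source-coding converse uses no mutual information. Jensen's inequality and a sum over all
codewords bound the exponential of minus the weighted mean distortion by the codebook size times an
explicit product (`rateGain_sub_distortion_le_log_card`). Choosing the multipliers well recovers the
rate-distortion function (`exists_rateGain_sub_mul_ge`). -/

/-- The gain `log q - log (1 + (q - 1) e⁻ˡ)`: minus the logarithm of the moment generating function
at `-l` of the Hamming distortion between a uniform letter and a fixed one. The rate-distortion
function is, in nats, the supremum over `l ≥ 0` of `rateGain q l - l * D`. -/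
noncomputable def rateGain (q : ℕ) (l : ℝ) : ℝ :=
  Real.log q - Real.log (1 + ((q : ℝ) - 1) * Real.exp (-l))

lemma rateGain_zero {q : ℕ} : rateGain q 0 = 0 := by
  simp [rateGain]

lemma distortion_nonneg {A : Type*} (s t : A) : 0 ≤ distortion s t := by
  unfold distortion; split_ifs <;> norm_num

lemma distortion_le_one {A : Type*} (s t : A) : distortion s t ≤ 1 := by
  unfold distortion; split_ifs <;> norm_num

/-! ### Lossy source coding converse -/

section Source

variable {A : Type*} [Fintype A]

/-- One letter agrees with `t` and all others are at distortion one. The value does not depend on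
`t`, so every codeword has the same exponential moment. -/
lemma sum_exp_distortion (l : ℝ) (t : A) :
    ∑ s : A, Real.exp (-(l * distortion s t)) =
      1 + ((Fintype.card A : ℝ) - 1) * Real.exp (-l) := by
  classical
  have h : ∀ s : A, Real.exp (-(l * distortion s t)) =
      Real.exp (-l) + if s = t then 1 - Real.exp (-l) else 0 := by
    intro s
    unfold distortion
    split_ifs <;> simp
  simp only [h, Finset.sum_add_distrib, Finset.sum_ite_eq', Finset.mem_univ, if_true,
    Finset.sum_const, Finset.card_univ, nsmul_eq_mul]
  ring

lemma sum_prod_pi {ι β : Type*} [Fintype ι] [DecidableEq ι] [Fintype β] (w : ι → β → ℝ) :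
    ∑ x : ι → β, ∏ i, w i (x i) = ∏ i, ∑ b, w i b := by
  rw [Finset.prod_univ_sum, Fintype.piFinset_univ]

lemma one_add_card_sub_one_mul_exp_pos [Nonempty A] (l : ℝ) :
    0 < 1 + ((Fintype.card A : ℝ) - 1) * Real.exp (-l) := by
  have h : (1 : ℝ) ≤ Fintype.card A := by exact_mod_cast Fintype.card_pos (α := A)
  have := mul_nonneg (sub_nonneg.2 h) (Real.exp_pos (-l)).le
  linarith

lemma exp_neg_rateGain [Nonempty A] (l : ℝ) :
    Real.exp (-rateGain (Fintype.card A) l) * Fintype.card A =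
      1 + ((Fintype.card A : ℝ) - 1) * Real.exp (-l) := by
  have h : (0 : ℝ) < Fintype.card A := by exact_mod_cast Fintype.card_pos (α := A)
  rw [rateGain, neg_sub, Real.exp_sub, Real.exp_log h,
    Real.exp_log (one_add_card_sub_one_mul_exp_pos l)]
  field_simp

/-- The exponential moment of the total weighted distortion to fixed reconstructions. -/
lemma sum_exp_weighted_distortion [Nonempty A] {N F : ℕ} (l : Fin N → ℝ)
    (y : Fin N → File A F) :
    ∑ W : Fin N → File A F, Real.exp (-∑ n, l n * ∑ i, distortion (W n i) (y n i)) =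
      Real.exp (-(F * ∑ n, rateGain (Fintype.card A) (l n))) *
        Fintype.card (Fin N → File A F) := by
  have h1 : ∀ W : Fin N → File A F,
      Real.exp (-∑ n, l n * ∑ i, distortion (W n i) (y n i)) =
        ∏ n, ∏ i, Real.exp (-(l n * distortion (W n i) (y n i))) := by
    intro W
    simp only [← Real.exp_sum, Finset.mul_sum, Finset.sum_neg_distrib]
  have h2 : ∀ n, ∑ x : File A F, ∏ i, Real.exp (-(l n * distortion (x i) (y n i))) =
      (Real.exp (-rateGain (Fintype.card A) (l n)) * Fintype.card A) ^ F := by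
    intro n
    rw [sum_prod_pi (fun i a => Real.exp (-(l n * distortion a (y n i))))]
    simp [sum_exp_distortion, exp_neg_rateGain]
  simp only [h1]
  rw [sum_prod_pi (fun n (x : File A F) => ∏ i, Real.exp (-(l n * distortion (x i) (y n i))))]
  simp only [h2]
  simp only [mul_pow, Finset.prod_mul_distrib, ← Real.exp_nat_mul, ← Real.exp_sum]
  simp [Finset.mul_sum]

lemma exp_average_le_average_exp {Ω : Type*} [Fintype Ω] [Nonempty Ω] (f : Ω → ℝ) :
    Real.exp ((∑ w, f w) / Fintype.card Ω) ≤ (∑ w, Real.exp (f w)) / Fintype.card Ω := by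
  have hc : (0 : ℝ) < Fintype.card Ω := by exact_mod_cast Fintype.card_pos (α := Ω)
  have := convexOn_exp.map_sum_le (t := Finset.univ) (w := fun _ : Ω => (Fintype.card Ω : ℝ)⁻¹)
    (p := f) (fun _ _ => by positivity) (by simp [hc.ne']) (fun _ _ => Set.mem_univ _)
  simpa [smul_eq_mul, ← Finset.mul_sum, div_eq_inv_mul] using this

/-- Lagrangian form of the converse to lossy source coding of `N` files with a codebook `C`. -/
lemma rateGain_sub_distortion_le_log_card [Nonempty A] {N F : ℕ} {C : Type*} [Fintype C]
    (enc : (Fin N → File A F) → C) (y : C → Fin N → File A F) (l : Fin N → ℝ) :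
    F * ∑ n, rateGain (Fintype.card A) (l n) -
        ∑ n, l n * ((∑ W : Fin N → File A F, ∑ i, distortion (W n i) (y (enc W) n i)) /
          Fintype.card (Fin N → File A F)) ≤ Real.log (Fintype.card C) := by
  set G := F * ∑ n, rateGain (Fintype.card A) (l n) with hG
  set S := ∑ n, l n * ((∑ W : Fin N → File A F, ∑ i, distortion (W n i) (y (enc W) n i)) /
    Fintype.card (Fin N → File A F)) with hS
  have hc : (0 : ℝ) < Fintype.card (Fin N → File A F) := by
    exact_mod_cast Fintype.card_pos (α := Fin N → File A F)
  have hCne : Nonempty C := (inferInstance : Nonempty (Fin N → File A F)).map enc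
  have hC : (0 : ℝ) < Fintype.card C := by exact_mod_cast Fintype.card_pos (α := C)
  have havg : -S = (∑ W : Fin N → File A F,
      -∑ n, l n * ∑ i, distortion (W n i) (y (enc W) n i)) /
        Fintype.card (Fin N → File A F) := by
    rw [hS, Finset.sum_neg_distrib, Finset.sum_comm, neg_div, Finset.sum_div]
    simp only [Finset.mul_sum, Finset.sum_div, mul_div_assoc]
  have hbound : Real.exp (-S) ≤ Fintype.card C * Real.exp (-G) := by
    rw [havg]
    refine (exp_average_le_average_exp _).trans ?_
    rw [div_le_iff₀ hc]
    -- Summing over all codewords removes the dependence on the encoder, at the cost of a factor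
    -- `card C`.
    calc _ ≤ ∑ W : Fin N → File A F, ∑ c : C,
          Real.exp (-∑ n, l n * ∑ i, distortion (W n i) (y c n i)) :=
          Finset.sum_le_sum fun W _ => Finset.single_le_sum
            (f := fun c => Real.exp (-∑ n, l n * ∑ i, distortion (W n i) (y c n i)))
            (fun _ _ => (Real.exp_pos _).le) (Finset.mem_univ (enc W))
      _ = _ := by
          rw [Finset.sum_comm]
          simp [sum_exp_weighted_distortion, hG, mul_assoc]
  rw [← Real.exp_log hC, ← Real.exp_add, Real.exp_le_exp] at hbound
  linarith

/-- The same converse for the reconstruction of only some of the files. -/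
lemma rateGain_sub_distortion_le_log_card_of_injective [Nonempty A] {N F : ℕ}
    {C J : Type*} [Fintype C] [Fintype J] {e : J → Fin N} (he : Function.Injective e)
    (enc : (Fin N → File A F) → C) (y : C → J → File A F) (l : J → ℝ) :
    F * ∑ j, rateGain (Fintype.card A) (l j) -
        ∑ j, l j * ((∑ W : Fin N → File A F, ∑ i, distortion (W (e j) i) (y (enc W) j i)) /
          Fintype.card (Fin N → File A F)) ≤ Real.log (Fintype.card C) := by
  classical
  obtain ⟨a⟩ := (inferInstance : Nonempty (File A F))
  have h := rateGain_sub_distortion_le_log_card enc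
    -- Files outside the range of `e` get multiplier `0`, so they contribute neither gain nor
    -- distortion.
    (fun c => Function.extend e (y c) fun _ => a) (Function.extend e l 0)
  rw [← Fintype.sum_of_injective e he (fun j => rateGain (Fintype.card A) (l j)),
    ← Fintype.sum_of_injective e he (fun j => l j *
      ((∑ W : Fin N → File A F, ∑ i, distortion (W (e j) i) (y (enc W) j i)) /
        Fintype.card (Fin N → File A F)))] at h
  · exact h
  · intro n hn
    rw [Function.extend_apply' _ _ _ hn]
    simp
  · intro j
    simp only [he.extend_apply]
  · intro n hn
    rw [Function.extend_apply' _ _ _ hn]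
    exact rateGain_zero
  · intro j
    rw [he.extend_apply]

end Source

/-- The rate-distortion function is approached by its Lagrangian lower bounds. -/
lemma exists_rateGain_sub_mul_ge {q : ℕ} (hq : 2 ≤ q) {D : ℝ} (hD0 : 0 ≤ D)
    (hD1 : D ≤ 1 - 1 / (q : ℝ)) {ε : ℝ} (hε : 0 < ε) :
    ∃ l : ℝ, 0 ≤ l ∧ rateDistortion q D * Real.log 2 - ε ≤ rateGain q l - l * D := by
  have hq' : (2 : ℝ) ≤ q := by exact_mod_cast hq
  have hq0 : (0 : ℝ) < q := by linarith
  have hlog2 : Real.log 2 ≠ 0 := (Real.log_pos one_lt_two).ne'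
  have hrd : rateDistortion q D * Real.log 2 =
      Real.log q - Real.binEntropy D - D * Real.log ((q : ℝ) - 1) := by
    unfold rateDistortion Real.logb
    field_simp
  rw [hrd]
  rcases hD0.eq_or_lt with rfl | hpos
  -- At `D = 0` the supremum is only approached as `l → ∞`; hence the slack `ε`.
  · have hlim : Tendsto (fun l : ℝ => Real.log (1 + ((q : ℝ) - 1) * Real.exp (-l))) atTop (𝓝 0) := by
      have h1 : Tendsto (fun l : ℝ => 1 + ((q : ℝ) - 1) * Real.exp (-l)) atTop (𝓝 1) := by
        simpa using (Real.tendsto_exp_neg_atTop_nhds_zero.const_mul ((q : ℝ) - 1)).const_add 1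
      simpa using h1.log one_ne_zero
    obtain ⟨l, hl, hl0⟩ := ((hlim.eventually_lt_const hε).and (eventually_ge_atTop 0)).exists
    refine ⟨l, hl0, ?_⟩
    simp [rateGain]
    linarith
  · have h1D : 0 < 1 - D := by
      have : 0 < 1 / (q : ℝ) := by positivity
      linarith
    have hq1 : (0 : ℝ) < q - 1 := by linarith
    -- The stationary point of `rateGain q l - l * D`; it is nonnegative because `D ≤ 1 - 1/q`.
    refine ⟨-Real.log (D / ((1 - D) * (q - 1))), ?_, ?_⟩
    · rw [neg_nonneg]
      refine Real.log_nonpos (by positivity) ((div_le_one (by positivity)).2 ?_)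
      have : D * q ≤ q - 1 := by
        calc D * q ≤ (1 - 1 / (q : ℝ)) * q := by gcongr
          _ = q - 1 := by field_simp
      linarith
    · have hexp : 1 + ((q : ℝ) - 1) * Real.exp (- -Real.log (D / ((1 - D) * (q - 1)))) =
          (1 - D)⁻¹ := by
        rw [neg_neg, Real.exp_log (by positivity)]
        field_simp
        ring
      rw [rateGain, hexp, Real.log_inv, Real.log_div hpos.ne' (by positivity),
        Real.log_mul h1D.ne' hq1.ne', Real.binEntropy, Real.log_inv, Real.log_inv]
      nlinarith

/-! ### Cut-set bounds for caching schemes -/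

lemma card_message_le (b : ℝ) : (Fintype.card (Message b) : ℝ) ≤ 2 ^ b := by
  rw [Fintype.card_fin]
  exact Nat.floor_le (by positivity)

lemma avgDistortion_mem_Icc {A : Type*} [Fintype A] {K N F : ℕ} {M : Fin K → ℝ} {R : ℝ}
    (s : CachingScheme A K N F M R) (d : Fin K → Fin N) (k : Fin K) :
    s.avgDistortion d k ∈ Set.Icc (0 : ℝ) 1 := by
  unfold CachingScheme.avgDistortion
  refine ⟨div_nonneg (Finset.sum_nonneg fun W _ => mul_nonneg (by positivity)
    (Finset.sum_nonneg fun i _ => distortion_nonneg _ _)) (by positivity), ?_⟩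
  refine div_le_one_of_le₀ ?_ (by positivity)
  calc _ ≤ ∑ W : Fin N → File A F, (1 : ℝ) := by
        refine Finset.sum_le_sum fun W _ => ?_
        calc _ ≤ 1 / (F : ℝ) * ∑ _i : Fin F, (1 : ℝ) := by
              gcongr
              exact distortion_le_one _ _
          _ ≤ 1 := by
              simp only [Finset.sum_const, Finset.card_univ, Fintype.card_fin, nsmul_eq_mul,
                mul_one, one_div]
              exact inv_mul_le_one
    _ = _ := by simp

/-- The cut-set inequality for one scheme: the users `κ i` make `T` successive demands, for
distinct files. -/
lemma CachingScheme.rateGain_sub_avgDistortion_le {A : Type*} [Fintype A] [Nonempty A]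
    {K N F : ℕ} (hF : 0 < F) {M : Fin K → ℝ} {R : ℝ} (s : CachingScheme A K N F M R)
    {T : ℕ} {I : Type*} [Fintype I] (κ : I → Fin K) (d : Fin T → Fin K → Fin N)
    (hd : Function.Injective fun p : Fin T × I => d p.1 (κ p.2)) (l : I → ℝ) :
    ∑ t : Fin T, ∑ i, (rateGain (Fintype.card A) (l i) - l i * s.avgDistortion (d t) (κ i)) ≤
      (T * R + ∑ i, M (κ i)) * Real.log 2 := by
  classical
  have hF' : (0 : ℝ) < F := by exact_mod_cast hF
  -- Placement ignores the demands, so each cache is counted once rather than `T` times.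
  let C := (Fin T → (S : UserSet K) → Message (s.v S * F)) × ((i : I) → Message (M (κ i) * F))
  let enc : (Fin N → File A F) → C := fun W =>
    (fun t S => s.encode S (d t) fun j => W (d t j), fun i => s.place (κ i) W)
  have h := rateGain_sub_distortion_le_log_card_of_injective hd enc
    (fun c p => s.decode (d p.1) (κ p.2) (c.1 p.1) (c.2 p.2)) (fun p => l p.2)
  have hcard : (Fintype.card C : ℝ) ≤ 2 ^ ((T * R + ∑ i, M (κ i)) * F) := by
    have h1 : (Fintype.card C : ℝ) =
        (∏ S : UserSet K, (Fintype.card (Message (s.v S * F)) : ℝ)) ^ T *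
          ∏ i, (Fintype.card (Message (M (κ i) * F)) : ℝ) := by
      simp only [C, Fintype.card_prod, Fintype.card_pi, Finset.prod_const, Finset.card_univ,
        Fintype.card_fin]
      push_cast
      rfl
    rw [h1]
    calc _ ≤ (∏ S : UserSet K, (2 : ℝ) ^ (s.v S * F)) ^ T * ∏ i, (2 : ℝ) ^ (M (κ i) * F) := by
          gcongr <;> exact card_message_le _
      _ = _ := by
          rw [← Real.rpow_sum_of_pos two_pos, ← Real.rpow_sum_of_pos two_pos,
            ← Real.rpow_mul_natCast two_pos.le, ← Real.rpow_add two_pos, ← Finset.sum_mul,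
            ← Finset.sum_mul, s.v_sum]
          congr 1
          ring
  have hCne : Nonempty C := (inferInstance : Nonempty (Fin N → File A F)).map enc
  have hC : (0 : ℝ) < Fintype.card C := by exact_mod_cast Fintype.card_pos (α := C)
  have hlog := Real.log_le_log hC hcard
  rw [Real.log_rpow two_pos] at hlog
  have hdist : ∀ t i, (∑ W : Fin N → File A F, ∑ a, distortion (W (d t (κ i)) a)
      (s.decode (d t) (κ i) ((enc W).1 t) ((enc W).2 i) a)) /
        Fintype.card (Fin N → File A F) = F * s.avgDistortion (d t) (κ i) := by
    intro t i
    unfold CachingScheme.avgDistortion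
    rw [← Finset.mul_sum, ← mul_div_assoc, ← mul_assoc, mul_one_div_cancel hF'.ne', one_mul]
    rfl
  simp only [Fintype.sum_prod_type, hdist] at h
  refine le_of_mul_le_mul_left ?_ hF'
  calc _ = _ := by
        simp only [Finset.sum_sub_distrib, mul_sub, Finset.mul_sum]
        refine congrArg₂ _ rfl (Finset.sum_congr rfl fun t _ => Finset.sum_congr rfl fun i _ => ?_)
        exact mul_left_comm _ _ _
    _ ≤ _ := h.trans hlog
    _ = _ := by ring

/-- The limsup condition gives distortion below `D + δ` at some positive `F`; nonnegative
multipliers preserve this bound, and then `δ → 0`. -/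
lemma Achievable.sum_rateGain_le {A : Type*} [Fintype A] [Nonempty A] {K N : ℕ}
    {D m : Fin K → ℝ} {R : ℝ} (h : Achievable A N D m R) {T : ℕ} {I : Type*} [Fintype I]
    (κ : I → Fin K) (d : Fin T → Fin K → Fin N)
    (hd : Function.Injective fun p : Fin T × I => d p.1 (κ p.2)) {l : I → ℝ}
    (hl : ∀ i, 0 ≤ l i) :
    T * ∑ i, (rateGain (Fintype.card A) (l i) - l i * D (κ i)) ≤
      (T * R + N * ∑ i, m (κ i)) * Real.log 2 := by
  obtain ⟨s, hs⟩ := h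
  have key : ∀ δ > 0, T * ∑ i, (rateGain (Fintype.card A) (l i) - l i * (D (κ i) + δ)) ≤
      (T * R + N * ∑ i, m (κ i)) * Real.log 2 := by
    intro δ hδ
    have hev : ∀ᶠ F in atTop, ∀ t i, (s F).avgDistortion (d t) (κ i) < D (κ i) + δ := by
      refine eventually_all.2 fun t => eventually_all.2 fun i => ?_
      refine eventually_lt_of_limsup_lt ((hs (d t) (κ i)).trans_lt (lt_add_of_pos_right _ hδ)) ?_
      exact isBoundedUnder_of ⟨1, fun F => (avgDistortion_mem_Icc (s F) _ _).2⟩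
    obtain ⟨F, hF, hF0⟩ := (hev.and (eventually_gt_atTop 0)).exists
    have h := (s F).rateGain_sub_avgDistortion_le hF0 κ d hd l
    rw [← Finset.mul_sum] at h
    refine le_trans ?_ h
    calc _ = ∑ _t : Fin T, ∑ i, (rateGain (Fintype.card A) (l i) - l i * (D (κ i) + δ)) := by
          simp [mul_sub]
      _ ≤ _ := by
          refine Finset.sum_le_sum fun t _ => Finset.sum_le_sum fun i _ => ?_
          exact sub_le_sub_left (mul_le_mul_of_nonneg_left (hF t i).le (hl i)) _
  have hlim : Tendsto (fun δ : ℝ =>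
      (T : ℝ) * ∑ i, (rateGain (Fintype.card A) (l i) - l i * (D (κ i) + δ))) (𝓝[>] 0)
      (𝓝 (T * ∑ i, (rateGain (Fintype.card A) (l i) - l i * (D (κ i) + 0)))) :=
    (Continuous.tendsto (by fun_prop) 0).mono_left nhdsWithin_le_nhds
  rw [← sub_nonneg] at *
  simpa using ge_of_tendsto (hlim.const_sub _)
    (eventually_mem_nhdsWithin.mono fun δ hδ => sub_nonneg.2 (key δ hδ))

/-- The cut-set bound for the users `κ i`, who together request `T` times distinct files. -/
lemma Achievable.cutSet {A : Type*} [Fintype A] [Nontrivial A] {K N : ℕ} (hN : 0 < N)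
    {D m : Fin K → ℝ} {R : ℝ} (h : Achievable A N D m R)
    (hD0 : ∀ k, 0 ≤ D k) (hD1 : ∀ k, D k ≤ 1 - 1 / (Fintype.card A : ℝ))
    {T L : ℕ} (hTL : T * L ≤ N) {κ : Fin L → Fin K} (hκ : Function.Injective κ) :
    T * ∑ i, rateDistortion (Fintype.card A) (D (κ i)) ≤ T * R + N * ∑ i, m (κ i) := by
  have hlog2 : 0 < Real.log 2 := Real.log_pos one_lt_two
  -- The pairs (round, user) number distinct files, available since `T * L ≤ N`; users outside the
  -- cut request an arbitrary file.
  let d : Fin T → Fin K → Fin N := fun t =>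
    Function.extend κ (fun i => Fin.castLE hTL (finProdFinEquiv (t, i))) fun _ => ⟨0, hN⟩
  have hd : Function.Injective fun p : Fin T × Fin L => d p.1 (κ p.2) := by
    intro p p' hp
    simp only [d, hκ.extend_apply] at hp
    exact finProdFinEquiv.injective (Fin.castLE_injective hTL hp)
  have key : ∀ ε > 0,
      T * ∑ i, (rateDistortion (Fintype.card A) (D (κ i)) * Real.log 2 - ε) ≤
        (T * R + N * ∑ i, m (κ i)) * Real.log 2 := by
    intro ε hε
    choose l hl0 hl using fun i =>
      exists_rateGain_sub_mul_ge (Fintype.one_lt_card (α := A)) (hD0 (κ i)) (hD1 (κ i)) hε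
    refine le_trans ?_ (h.sum_rateGain_le κ d hd hl0)
    exact mul_le_mul_of_nonneg_left (Finset.sum_le_sum fun i _ => hl i) (Nat.cast_nonneg T)
  have hlim : Tendsto (fun ε : ℝ =>
      (T : ℝ) * ∑ i, (rateDistortion (Fintype.card A) (D (κ i)) * Real.log 2 - ε)) (𝓝[>] 0)
      (𝓝 (T * ∑ i, (rateDistortion (Fintype.card A) (D (κ i)) * Real.log 2 - 0))) :=
    (Continuous.tendsto (by fun_prop) 0).mono_left nhdsWithin_le_nhds
  have hle := le_of_tendsto hlim (eventually_mem_nhdsWithin.mono fun ε hε => key ε hε)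
  simp only [sub_zero, ← Finset.sum_mul, ← mul_assoc] at hle
  exact le_of_mul_le_mul_right hle hlog2

end CodedCaching

theorem corollary1 {A : Type*} [Field A] [Fintype A] (N : ℕ) (hN : 3 ≤ N)
    (D : Fin 3 → ℝ) (hD : Antitone D)
    (hD0 : ∀ k, 0 ≤ D k) (hD1 : ∀ k, D k ≤ 1 - 1 / (Fintype.card A : ℝ))
    (r : Fin 3 → ℝ) (hr : ∀ k, r k = CodedCaching.rateDistortion (Fintype.card A) (D k))
    (mtot : ℝ) (hm0 : 0 ≤ mtot) (hm1 : mtot ≤ ∑ l, r l) :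
    ((max (max
        ((∑ l, r l) - (N : ℝ) / ((N / 3 : ℕ) : ℝ) * mtot)
        ((((N / 2 : ℕ) : ℝ) * (r 0 + r 1) + (N : ℝ) * r 2) / ((N : ℝ) + ((N / 2 : ℕ) : ℝ))
          - (N : ℝ) / ((N : ℝ) + ((N / 2 : ℕ) : ℝ)) * mtot))
        ((1 / 3 : ℝ) * ((∑ l, r l) - mtot)) : ℝ) : EReal)
      ≤ CodedCaching.optimalLoadBudget A N mtot D := by
  unfold CodedCaching.optimalLoadBudget CodedCaching.optimalLoad
  refine le_iInf₂ fun m hm => le_iInf₂ fun R hR => EReal.coe_le_coe_iff.2 ?_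
  have hN0 : 0 < N := by omega
  have hNr : (0 : ℝ) < N := by exact_mod_cast hN0
  have hsum : m 0 + m 1 + m 2 = mtot := by
    have := hm.2
    rwa [Fin.sum_univ_three] at this
  have h3 := hR.cutSet hN0 hD0 hD1 (Nat.div_mul_le_self N 3) (κ := id) Function.injective_id
  have h2 := hR.cutSet hN0 hD0 hD1 (Nat.div_mul_le_self N 2) (κ := ![0, 1]) (by decide)
  have h1 : ∀ k, r k ≤ R + m k := by
    intro k
    have h := hR.cutSet hN0 hD0 hD1 (mul_one N).le (κ := fun _ : Fin 1 => k)
      (Function.injective_of_subsingleton _)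
    simp only [Fin.sum_univ_one, ← hr, ← mul_add] at h
    exact le_of_mul_le_mul_left h hNr
  simp only [← hr, Fin.sum_univ_three, id, hsum] at h3
  simp only [← hr, Fin.sum_univ_two, Matrix.cons_val_zero, Matrix.cons_val_one] at h2
  have hT3 : (0 : ℝ) < (N / 3 : ℕ) := by exact_mod_cast Nat.div_pos hN three_pos
  have hT2 : (0 : ℝ) ≤ (N / 2 : ℕ) := Nat.cast_nonneg _
  rw [Fin.sum_univ_three]
  refine max_le (max_le ?_ ?_) ?_
  · rw [sub_le_iff_le_add, div_mul_eq_mul_div, ← sub_le_iff_le_add', le_div_iff₀ hT3]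
    linarith
  · rw [div_mul_eq_mul_div, ← sub_div, div_le_iff₀ (by positivity), ← hsum]
    -- `N` times the bound for the last user, added to the two-user cut, completes the cache total
    -- to `mtot`.
    have := mul_le_mul_of_nonneg_left (h1 2) hNr.le
    linarith
  · linarith [h1 0, h1 1, h1 2]
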